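/- **Proposition (lower bound for Gaussian mean estimation with adversarial contamination).** For integers $n,p\ge 1$, a vector $\mu^*\in\mathbb R^p$, a symmetric positive semidefinite matrix $\Sigma\in\mathbb R^{p\times p}$ and $\varepsilon\in(0,1/2)$, let $\mathrm{GAC}(\mu^*,\Sigma,\varepsilon)$ be the set of all joint distributions $\mathbf P_n$ of random vectors $X_1,\dots,X_n$ in $\mathbb R^p$ for which there are, on the same probability space, independent random vectors $Y_1,\dots,Y_n\sim\mathcal N_p(\mu^*,\Sigma)$ with $$\big|\{i: X_i\ne Y_i\}\big|\le \varepsilon n \quad\text{almost surely.}$$ For an estimator $\widehat\mu_n$, i.e. a measurable function $(\mathbb R^p)^n\to\mathbb R^p$ of $(X_1,\dots,X_n)$, put $$R_{\max}(\widehat\mu_n,\Sigma,\varepsilon)=\sup_{\mu^*\in\mathbb R^p}\ \sup_{\mathbf P_n\in\mathrm{GAC}(\mu^*,\Sigma,\varepsilon)}\Big(\mathbf E_{\mathbf P_n}\big\|\widehat\mu_n-\mu^*\big\|_2^2\Big)^{1/2}\in[0,+\infty].$$ Let $\|\Sigma\|_{\mathrm{op}}$ be the operator norm of $\Sigma$ and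 $\mathbf r_\Sigma=\mathrm{Tr}(\Sigma)/\|\Sigma\|_{\mathrm{op}}$ its effective rank. Then there exist universal constants $c,\widetilde c>0$ such that, for all integers $n>\widetilde c$ and $p\ge 1$, every symmetric positive semidefinite $\Sigma\in\mathbb R^{p\times p}$ and every $\varepsilon\in(0,1/2)$, $$\inf_{\widehat\mu_n} R_{\max}(\widehat\mu_n,\Sigma,\varepsilon)\ \ge\ c\,\|\Sigma\|_{\mathrm{op}}^{1/2}\Big(\sqrt{\frac{\mathbf r_\Sigma}{n}}+\varepsilon\Big),$$ where the infimum is over all measurable functions of $(X_1,\dots,X_n)$, and the right-hand side is read as $0$ when $\Sigma=0$. -/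

import Mathlib

open MeasureTheory ProbabilityTheory

namespace RobustMean

/-- The set of laws `P` of data `(X₁, …, Xₙ)` in `ℝᵖ` that are Gaussian with adversarial
contamination: on some probability space there are random vectors `X₁, …, Xₙ` with joint law `P`
and i.i.d. vectors `Y₁, …, Yₙ ∼ 𝒩(m, S)` such that `|{i : Xᵢ ≠ Yᵢ}| ≤ ε n` almost surely.
No relation between `X` and `Y` is imposed beyond this. -/
def GAC (n : ℕ) {p : ℕ} (m : EuclideanSpace ℝ (Fin p)) (S : Matrix (Fin p) (Fin p) ℝ) (ε : ℝ) :
    Set (Measure (Fin n → EuclideanSpace ℝ (Fin p))) :=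
  {P | ∃ (Ω : Type) (_ : MeasurableSpace Ω) (Q : Measure Ω) (_ : IsProbabilityMeasure Q)
      (X Y : Fin n → Ω → EuclideanSpace ℝ (Fin p)),
      HasLaw (fun ω i => X i ω) P Q ∧
      iIndepFun Y Q ∧
      (∀ i, HasLaw (Y i) (multivariateGaussian m S) Q) ∧
      ∀ᵐ ω ∂Q, ({i | X i ω ≠ Y i ω}.ncard : ℝ) ≤ ε * n}

/-- The risk `‖est - m‖_{𝕃₂(P)} = (E_P ‖est(X₁, …, Xₙ) - m‖₂²)^{1/2}`, with values in `[0, ∞]`. -/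
noncomputable def risk {n p : ℕ} (P : Measure (Fin n → EuclideanSpace ℝ (Fin p)))
    (est : (Fin n → EuclideanSpace ℝ (Fin p)) → EuclideanSpace ℝ (Fin p))
    (m : EuclideanSpace ℝ (Fin p)) : ENNReal :=
  eLpNorm (fun x => est x - m) 2 P

/-- The worst-case risk of `est` over all means `m` and all laws in `GAC(m, S, ε)`. -/
noncomputable def maxRisk {n p : ℕ}
    (est : (Fin n → EuclideanSpace ℝ (Fin p)) → EuclideanSpace ℝ (Fin p))
    (S : Matrix (Fin p) (Fin p) ℝ) (ε : ℝ) : ENNReal :=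
  ⨆ (m : EuclideanSpace ℝ (Fin p)), ⨆ P ∈ GAC n m S ε, risk P est m

/-- The operator norm of a matrix with respect to the Euclidean norm. -/
noncomputable def opNorm {p : ℕ} (S : Matrix (Fin p) (Fin p) ℝ) : ℝ :=
  ‖Matrix.toEuclideanCLM (𝕜 := ℝ) S‖

/-- The effective rank `Tr S / ‖S‖_op`. -/
noncomputable def effRank {p : ℕ} (S : Matrix (Fin p) (Fin p) ℝ) : ℝ :=
  S.trace / opNorm S

end RobustMean

/-!
The two terms of the bound are proved separately, each as a lower bound for the square of the
maximal risk `R` of an arbitrary measurable estimator. Both use that an estimator which sees the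
same data under the means `m` and `m'` has squared errors adding up to at least `‖m - m'‖² / 2`
(`enorm_sub_sq_le`).

*Sampling error* (`ofReal_trace_div_le_maxRisk_sq`): `R² ≥ Tr S / (2 n)`, without contamination.
Put the prior `N(0, S / n)` on the mean, so that the mean is `S^{1/2} x₀ / √n` and the observations
are `S^{1/2} (x₀ / √n + xᵢ)` with `x₀, …, xₙ` i.i.d. standard Gaussian. The reflection of the index
space `ℝⁿ⁺¹` along the unit vector `u = (1, -1/√n, …, -1/√n) / √2` preserves the law of
`(x₀, …, xₙ)` (`measurePreserving_reflection_stdGaussian`) and fixes all the observations, but it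
moves the mean by `√(2 / n) S^{1/2} w`, where `w = ∑ uⱼ xⱼ` is again standard Gaussian. Hence the
Bayes risk is at least `(1 / 4) (2 / n) E ‖S^{1/2} w‖² = Tr S / (2 n)`. The argument uses no
posterior distribution and no integrability of the estimator.

*Contamination* (`ofReal_opNorm_le_maxRisk_sq`): `R² ≥ ε² ‖S‖ / 32`. The laws `N(0, 1)` and
`N(ε, 1)` have a coupling with `P(s ≠ s') ≤ ε / 2` (`exists_coupling_gaussianReal`). Inserting `s`
and `s'` as the component along a unit vector `w` of a standard Gaussian vector and applying
`S^{1/2}` couples `N(0, S)` with `N(ε S^{1/2} w, S)`, and `w` is chosen such that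
`‖S^{1/2} w‖² ≥ ‖S‖ / 4`. Among `n` independent copies the expected number of disagreements is at
most `ε n / 2`, so by Markov's inequality it exceeds the budget `ε n` with probability at most
`1 / 2`. Within the budget the adversary passes from the first sample to the second, and the two
means cannot be told apart (`ofReal_norm_sub_sq_le_maxRisk_sq`). This works for every `ε > 0`, even
if `ε n < 1`.
-/

namespace RobustMean

/-! ### Standard Gaussian vectors under linear maps -/

section StdGaussian

open scoped RealInnerProductSpace

variable {V F : Type*} [NormedAddCommGroup V] [InnerProductSpace ℝ V] [FiniteDimensional ℝ V]
  [MeasurableSpace V] [BorelSpace V]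
  [NormedAddCommGroup F] [InnerProductSpace ℝ F] [FiniteDimensional ℝ F]
  [MeasurableSpace F] [BorelSpace F]

/-- A map whose adjoint `g` is isometric sends a standard Gaussian vector to a standard Gaussian
vector. -/
lemma map_stdGaussian_of_adjoint {f : V → F} (hf : Measurable f) (g : F → V)
    (hfg : ∀ x t, ⟪f x, t⟫ = ⟪x, g t⟫) (hg : ∀ t, ‖g t‖ = ‖t‖) :
    (stdGaussian V).map f = stdGaussian F := by
  have : IsProbabilityMeasure ((stdGaussian V).map f) :=
    Measure.isProbabilityMeasure_map hf.aemeasurable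
  apply Measure.ext_of_charFun
  ext t
  have h : charFun ((stdGaussian V).map f) t = charFun (stdGaussian V) (g t) := by
    rw [charFun_apply, charFun_apply, integral_map hf.aemeasurable
      (Measurable.aestronglyMeasurable (by fun_prop))]
    simp_rw [hfg]
  rw [h, charFun_stdGaussian, charFun_stdGaussian, hg]

lemma map_toLp_pi_stdGaussian {ι : Type*} [Fintype ι] :
    (Measure.pi fun _ : ι => stdGaussian V).map (WithLp.toLp 2) =
      stdGaussian (PiLp 2 fun _ : ι => V) := by
  have : IsProbabilityMeasure ((Measure.pi fun _ : ι => stdGaussian V).map (WithLp.toLp 2)) :=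
    Measure.isProbabilityMeasure_map (by fun_prop)
  apply Measure.ext_of_charFun
  ext t
  rw [charFun_pi, charFun_stdGaussian]
  simp_rw [charFun_stdGaussian, ← Complex.exp_sum, ← Finset.sum_div, Finset.sum_neg_distrib]
  rw [← Complex.ofReal_pow, PiLp.norm_sq_eq_of_L2]
  push_cast
  rfl

lemma map_toLp_prod_stdGaussian :
    ((stdGaussian V).prod (stdGaussian F)).map (WithLp.toLp 2) =
      stdGaussian (WithLp 2 (V × F)) := by
  have : IsProbabilityMeasure (((stdGaussian V).prod (stdGaussian F)).map (WithLp.toLp 2)) :=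
    Measure.isProbabilityMeasure_map (by fun_prop)
  apply Measure.ext_of_charFun
  ext t
  rw [charFun_prod, charFun_stdGaussian, charFun_stdGaussian, charFun_stdGaussian,
    ← Complex.exp_add, ← Complex.ofReal_pow ‖t‖, WithLp.prod_norm_sq_eq_of_L2]
  push_cast
  congr 1
  simp only [WithLp.ofLp_fst, WithLp.ofLp_snd]
  ring

lemma stdGaussian_real : stdGaussian ℝ = gaussianReal 0 1 := by
  apply Measure.ext_of_charFun
  ext t
  rw [charFun_stdGaussian, charFun_gaussianReal]
  congr 1
  rw [← Complex.ofReal_pow]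
  simp
  ring

/-- A combination `∑ uⱼ xⱼ` of independent standard Gaussian vectors with `∑ uⱼ² = 1` is
standard Gaussian. -/
lemma measurePreserving_sum_smul_stdGaussian {ι : Type*} [Fintype ι] {u : ι → ℝ}
    (hu : ∑ i, u i ^ 2 = 1) :
    MeasurePreserving (fun x : ι → V => ∑ j, u j • x j)
      (Measure.pi fun _ => stdGaussian V) (stdGaussian V) := by
  refine ⟨by fun_prop, ?_⟩
  have h := map_stdGaussian_of_adjoint (V := PiLp 2 fun _ : ι => V) (F := V)
    (f := fun x => ∑ j, u j • x j) (by fun_prop) (fun t => WithLp.toLp 2 fun j => u j • t)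
    (fun x t => by
      simp [PiLp.inner_apply, sum_inner, real_inner_smul_left, real_inner_smul_right])
    (fun t => by
      rw [← sq_eq_sq₀ (norm_nonneg _) (norm_nonneg _), PiLp.norm_sq_eq_of_L2]
      simp [norm_smul, mul_pow, ← Finset.sum_mul, hu])
  rw [← map_toLp_pi_stdGaussian, Measure.map_map (by fun_prop) (by fun_prop)] at h
  exact h

/-- The law of an i.i.d. standard Gaussian sample is invariant under the reflection in the
orthogonal complement of a unit vector `u` of the index space. -/
lemma measurePreserving_reflection_stdGaussian {ι : Type*} [Fintype ι] {u : ι → ℝ}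
    (hu : ∑ i, u i ^ 2 = 1) :
    MeasurePreserving (fun (x : ι → V) i => x i - (2 * u i) • ∑ j, u j • x j)
      (Measure.pi fun _ => stdGaussian V) (Measure.pi fun _ => stdGaussian V) := by
  refine ⟨by fun_prop, ?_⟩
  have h := map_stdGaussian_of_adjoint (V := PiLp 2 fun _ : ι => V) (F := PiLp 2 fun _ : ι => V)
    (f := fun x => WithLp.toLp 2 fun i => x i - (2 * u i) • ∑ j, u j • x j) (by fun_prop)
    (fun x => WithLp.toLp 2 fun i => x i - (2 * u i) • ∑ j, u j • x j)
    (fun x t => by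
      simp only [PiLp.inner_apply, inner_sub_left, inner_sub_right, Finset.sum_sub_distrib]
      congr 1
      have h1 : ∑ i, ⟪(2 * u i) • ∑ j, u j • x j, t i⟫ =
          2 * ⟪∑ j, u j • x j, ∑ j, u j • t j⟫ := by
        rw [inner_sum, Finset.mul_sum]
        refine Finset.sum_congr rfl fun i _ => ?_
        rw [real_inner_smul_left, real_inner_smul_right, mul_assoc]
      have h2 : ∑ i, ⟪x i, (2 * u i) • ∑ j, u j • t j⟫ =
          2 * ⟪∑ j, u j • x j, ∑ j, u j • t j⟫ := by
        rw [sum_inner, Finset.mul_sum]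
        refine Finset.sum_congr rfl fun i _ => ?_
        rw [real_inner_smul_left, real_inner_smul_right, mul_assoc]
      rw [h1, h2])
    (fun t => by
      rw [← sq_eq_sq₀ (norm_nonneg _) (norm_nonneg _), PiLp.norm_sq_eq_of_L2,
        PiLp.norm_sq_eq_of_L2]
      simp only [norm_sub_sq_real, norm_smul, mul_pow, Finset.sum_add_distrib,
        Finset.sum_sub_distrib]
      set w := ∑ j, u j • t.ofLp j with hw
      have h1 : ∑ i, 2 * ⟪t.ofLp i, (2 * u i) • w⟫ = 4 * ‖w‖ ^ 2 := by
        rw [← real_inner_self_eq_norm_sq w]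
        conv_rhs => rw [hw, sum_inner, ← hw, Finset.mul_sum]
        refine Finset.sum_congr rfl fun i _ => ?_
        simp only [real_inner_smul_left, real_inner_smul_right]
        ring
      have h2 : ∑ i, ‖2 * u i‖ ^ 2 * ‖w‖ ^ 2 = 4 * ‖w‖ ^ 2 := by
        rw [← Finset.sum_mul]
        simp [mul_pow, ← Finset.mul_sum, hu]
        left; norm_num
      rw [h1, h2]
      ring)
  rw [← map_toLp_pi_stdGaussian, Measure.map_map (by fun_prop) (by fun_prop)] at h
  apply (MeasurableEquiv.toLp 2 (ι → V)).map_measurableEquiv_injective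
  rw [Measure.map_map (by fun_prop) (by fun_prop)]
  exact h

/-- Replacing the component of a standard Gaussian vector along a unit vector `w` by an independent
standard Gaussian variable gives a standard Gaussian vector. -/
lemma measurePreserving_replace_coord {w : V} (hw : ‖w‖ = 1) :
    MeasurePreserving (fun q : V × ℝ => q.1 - ⟪q.1, w⟫ • w + q.2 • w)
      ((stdGaussian V).prod (gaussianReal 0 1)) (stdGaussian V) := by
  refine ⟨by fun_prop, ?_⟩
  have h := map_stdGaussian_of_adjoint (V := WithLp 2 (V × ℝ)) (F := V)
    (f := fun q => q.fst - ⟪q.fst, w⟫ • w + q.snd • w) (by fun_prop)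
    (fun t => WithLp.toLp 2 (t - ⟪t, w⟫ • w, ⟪t, w⟫))
    (fun x t => by
      simp [inner_add_left, inner_sub_left, inner_sub_right, real_inner_smul_left,
        real_inner_smul_right, real_inner_comm]
      ring)
    (fun t => by
      rw [← sq_eq_sq₀ (norm_nonneg _) (norm_nonneg _), WithLp.prod_norm_sq_eq_of_L2]
      simp [norm_sub_sq_real, norm_smul, real_inner_smul_right, hw]
      ring)
  rw [← map_toLp_prod_stdGaussian, Measure.map_map (by fun_prop) (by fun_prop),
    stdGaussian_real] at h
  exact h

end StdGaussian

/-! ### Couplings of two unit-variance Gaussians on the line -/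

section Coupling

open scoped ENNReal

/-- If `μ` and `ν` are probability measures with a common minorant `κ`, then there is a coupling of
`μ` and `ν` whose coordinates differ with probability at most `1 - κ univ`: put `κ` on
the diagonal and add the normalized product of the residual measures `μ - κ` and `ν - κ`. -/
lemma exists_coupling_of_le {α : Type*} [MeasurableSpace α] [MeasurableEq α] {μ ν κ : Measure α}
    [IsProbabilityMeasure μ] [IsProbabilityMeasure ν] (hμ : κ ≤ μ) (hν : κ ≤ ν) :
    ∃ ρ : Measure (α × α), IsProbabilityMeasure ρ ∧ ρ.map Prod.fst = μ ∧ ρ.map Prod.snd = ν ∧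
      ρ {p | p.1 ≠ p.2} ≤ 1 - κ Set.univ := by
  have : IsFiniteMeasure κ := isFiniteMeasure_of_le μ hμ
  have hr : ∀ τ : Measure α, IsProbabilityMeasure τ → κ ≤ τ →
      (τ - κ) Set.univ = 1 - κ Set.univ := fun τ _ h => by
    rw [Measure.sub_apply MeasurableSet.univ h, measure_univ]
  have hdiag : MeasurableSet {p : α × α | p.1 ≠ p.2} := measurableSet_diagonal.compl
  set η := 1 - κ Set.univ with hη
  have hη_top : η ≠ ∞ := ne_top_of_le_ne_top ENNReal.one_ne_top tsub_le_self
  -- If `η = 0` both residual measures vanish, so that the value `0⁻¹ = ∞` is harmless.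
  have hcancel : ∀ τ : Measure α, IsProbabilityMeasure τ → κ ≤ τ →
      η⁻¹ • η • (τ - κ) = τ - κ := fun τ hτ h => by
    rcases eq_or_ne η 0 with h0 | h0
    · have : τ - κ = 0 := by rw [← Measure.measure_univ_eq_zero, hr τ hτ h, h0]
      simp [this]
    · rw [smul_smul, ENNReal.inv_mul_cancel h0 hη_top, one_smul]
  let ρ : Measure (α × α) := κ.map (fun x => (x, x)) + η⁻¹ • (μ - κ).prod (ν - κ)
  have h1 : ρ.map Prod.fst = μ := by
    rw [Measure.map_add _ _ measurable_fst, Measure.map_map measurable_fst (by fun_prop),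
      Measure.map_smul, Measure.map_fst_prod, hr ν inferInstance hν, hcancel μ inferInstance hμ]
    change κ.map id + _ = _
    rw [Measure.map_id, add_comm, Measure.sub_add_cancel_of_le hμ]
  have h2 : ρ.map Prod.snd = ν := by
    rw [Measure.map_add _ _ measurable_snd, Measure.map_map measurable_snd (by fun_prop),
      Measure.map_smul, Measure.map_snd_prod, hr μ inferInstance hμ, hcancel ν inferInstance hν]
    change κ.map id + _ = _
    rw [Measure.map_id, add_comm, Measure.sub_add_cancel_of_le hν]
  have hρ : IsProbabilityMeasure ρ := by
    have : IsProbabilityMeasure (ρ.map Prod.fst) := h1 ▸ inferInstance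
    exact Measure.isProbabilityMeasure_of_map Prod.fst
  refine ⟨ρ, hρ, h1, h2, ?_⟩
  have h3 : κ.map (fun x => (x, x)) {p : α × α | p.1 ≠ p.2} = 0 := by
    rw [Measure.map_apply (by fun_prop) hdiag]
    simp
  calc ρ {p | p.1 ≠ p.2} = (η⁻¹ • (μ - κ).prod (ν - κ)) {p | p.1 ≠ p.2} := by
        simp only [ρ, Measure.add_apply, h3, zero_add]
    _ ≤ (η⁻¹ • (μ - κ).prod (ν - κ)) Set.univ := measure_mono (Set.subset_univ _)
    _ = η⁻¹ * (η * η) := by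
        rw [Measure.smul_apply, ← Set.univ_prod_univ, Measure.prod_prod, hr μ inferInstance hμ,
          hr ν inferInstance hν, smul_eq_mul]
    _ ≤ η := by
        rw [← mul_assoc]
        exact mul_le_of_le_one_left' (ENNReal.inv_mul_le_one η)

lemma gaussianPDFReal_one_le_half (x : ℝ) : gaussianPDFReal 0 1 x ≤ 1 / 2 := by
  have h2 : (2 : ℝ) ≤ √(2 * Real.pi * (1 : NNReal)) := by
    apply Real.le_sqrt_of_sq_le
    have := Real.two_le_pi
    push_cast
    linarith
  have h3 : Real.exp (-(x - 0) ^ 2 / (2 * (1 : NNReal))) ≤ 1 := by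
    rw [Real.exp_le_one_iff]
    have := sq_nonneg (x - 0)
    push_cast
    linarith
  rw [gaussianPDFReal, one_div]
  calc _ ≤ (2 : ℝ)⁻¹ * 1 := by gcongr
    _ = _ := mul_one _

lemma gaussianPDFReal_le_gaussianPDFReal {m m' x : ℝ} (h : (x - m) ^ 2 ≤ (x - m') ^ 2) :
    gaussianPDFReal m' 1 x ≤ gaussianPDFReal m 1 x := by
  unfold gaussianPDFReal
  gcongr

lemma gaussianReal_restrict_le {m m' : ℝ} {s : Set ℝ} (hs : MeasurableSet s)
    (h : ∀ x ∈ s, (x - m) ^ 2 ≤ (x - m') ^ 2) :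
    (gaussianReal m' 1).restrict s ≤ (gaussianReal m 1).restrict s := by
  rw [gaussianReal_of_var_ne_zero _ one_ne_zero, gaussianReal_of_var_ne_zero _ one_ne_zero,
    restrict_withDensity hs, restrict_withDensity hs]
  refine withDensity_mono ?_
  filter_upwards [ae_restrict_mem hs] with x hx
  exact ENNReal.ofReal_le_ofReal (gaussianPDFReal_le_gaussianPDFReal (h x hx))

lemma gaussianReal_Ioc_le (a b : ℝ) :
    gaussianReal 0 1 (Set.Ioc a b) ≤ ENNReal.ofReal ((b - a) / 2) := by
  rw [gaussianReal_apply _ one_ne_zero]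
  calc ∫⁻ x in Set.Ioc a b, gaussianPDF 0 1 x
      ≤ ∫⁻ _ in Set.Ioc a b, ENNReal.ofReal (1 / 2) :=
        lintegral_mono fun x => ENNReal.ofReal_le_ofReal (gaussianPDFReal_one_le_half x)
    _ = ENNReal.ofReal ((b - a) / 2) := by
        rw [setLIntegral_const, Real.volume_Ioc, ← ENNReal.ofReal_mul (by norm_num)]
        congr 1
        ring

/-- The common minorant of the two laws is the pointwise minimum of their densities, which is
`N(δ, 1)` to the left of the midpoint `δ / 2` and `N(0, 1)` to its right. -/
lemma exists_coupling_gaussianReal {δ : ℝ} (hδ : 0 ≤ δ) :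
    ∃ ρ : Measure (ℝ × ℝ), IsProbabilityMeasure ρ ∧ ρ.map Prod.fst = gaussianReal 0 1 ∧
      ρ.map Prod.snd = gaussianReal δ 1 ∧ ρ {p | p.1 ≠ p.2} ≤ ENNReal.ofReal (δ / 2) := by
  set μ := gaussianReal 0 1
  set ν := gaussianReal δ 1
  set κ : Measure ℝ := ν.restrict (Set.Iic (δ / 2)) + μ.restrict (Set.Iic (δ / 2))ᶜ
  have hμ : κ ≤ μ := by
    refine (add_le_add (gaussianReal_restrict_le measurableSet_Iic fun x hx => ?_) le_rfl).trans_eq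
      (Measure.restrict_add_restrict_compl (μ := μ) measurableSet_Iic)
    have : x ≤ δ / 2 := hx
    nlinarith
  have hν : κ ≤ ν := by
    refine (add_le_add le_rfl
      (gaussianReal_restrict_le measurableSet_Iic.compl fun x hx => ?_)).trans_eq
      (Measure.restrict_add_restrict_compl (μ := ν) measurableSet_Iic)
    have : δ / 2 < x := not_le.1 hx
    nlinarith
  obtain ⟨ρ, h0, h1, h2, h3⟩ := exists_coupling_of_le hμ hν
  refine ⟨ρ, h0, h1, h2, h3.trans ?_⟩
  rw [tsub_le_iff_left]
  have hshift : ν (Set.Iic (δ / 2)) = μ (Set.Iic (-(δ / 2))) := by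
    have : ν = μ.map (· + δ) := by rw [gaussianReal_map_add_const, zero_add]
    rw [this, Measure.map_apply (by fun_prop) measurableSet_Iic]
    congr 1
    ext x
    simp only [Set.mem_preimage, Set.mem_Iic]
    constructor <;> intro h <;> linarith
  have hIoc : μ (Set.Ioc (-(δ / 2)) (δ / 2)) ≤ ENNReal.ofReal (δ / 2) := by
    refine (gaussianReal_Ioc_le _ _).trans_eq ?_
    congr 1
    ring
  calc (1 : ℝ≥0∞) = μ (Set.Iic (δ / 2)) + μ (Set.Iic (δ / 2))ᶜ := by
        rw [measure_add_measure_compl measurableSet_Iic, measure_univ]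
    _ ≤ (μ (Set.Iic (-(δ / 2))) + μ (Set.Ioc (-(δ / 2)) (δ / 2))) + μ (Set.Iic (δ / 2))ᶜ := by
        gcongr
        refine (measure_mono ?_).trans (measure_union_le _ _)
        exact Set.Iic_subset_Iic_union_Ioc
    _ ≤ (ν (Set.Iic (δ / 2)) + ENNReal.ofReal (δ / 2)) + μ (Set.Iic (δ / 2))ᶜ := by
        rw [hshift]
        gcongr
    _ = κ Set.univ + ENNReal.ofReal (δ / 2) := by
        simp only [κ, Measure.add_apply, Measure.restrict_apply_univ]
        ring

end Coupling

/-! ### The squared risk -/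

section Risk

open scoped ENNReal

lemma enorm_sub_sq_le {E : Type*} [NormedAddCommGroup E] (a b c : E) :
    ‖a - b‖ₑ ^ 2 ≤ 2 * (‖c - a‖ₑ ^ 2 + ‖c - b‖ₑ ^ 2) := by
  simp only [← ofReal_norm, ← ENNReal.ofReal_pow (norm_nonneg _)]
  rw [← ENNReal.ofReal_add (by positivity) (by positivity), ← ENNReal.ofReal_ofNat 2,
    ← ENNReal.ofReal_mul (by norm_num)]
  apply ENNReal.ofReal_le_ofReal
  have h : ‖a - b‖ ≤ ‖c - a‖ + ‖c - b‖ := by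
    have := norm_sub_le (c - b) (c - a)
    rw [sub_sub_sub_cancel_left] at this
    linarith
  nlinarith [sq_nonneg (‖c - a‖ - ‖c - b‖), norm_nonneg (a - b)]

variable {n p : ℕ} {S : Matrix (Fin p) (Fin p) ℝ} {ε : ℝ}
  {est : (Fin n → EuclideanSpace ℝ (Fin p)) → EuclideanSpace ℝ (Fin p)}

lemma risk_sq (P : Measure (Fin n → EuclideanSpace ℝ (Fin p))) (m : EuclideanSpace ℝ (Fin p)) :
    risk P est m ^ 2 = ∫⁻ x, ‖est x - m‖ₑ ^ 2 ∂P := by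
  have := eLpNorm_nnreal_pow_eq_lintegral (f := fun x => est x - m) (μ := P)
    (p := 2) (by norm_num)
  simpa [risk] using this

/-- The mean squared error of `est` under any contaminated sample is at most `maxRisk ^ 2`. -/
lemma lintegral_enorm_sq_le_maxRisk_sq {Ω : Type} [MeasurableSpace Ω] {Q : Measure Ω}
    [IsProbabilityMeasure Q] {m : EuclideanSpace ℝ (Fin p)}
    {X Y : Fin n → Ω → EuclideanSpace ℝ (Fin p)} (hest : Measurable est)
    (hX : ∀ i, Measurable (X i)) (hY : iIndepFun Y Q)
    (hlaw : ∀ i, HasLaw (Y i) (multivariateGaussian m S) Q)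
    (hXY : ∀ ω, ({i | X i ω ≠ Y i ω}.ncard : ℝ) ≤ ε * n) :
    ∫⁻ ω, ‖est (fun i => X i ω) - m‖ₑ ^ 2 ∂Q ≤ maxRisk est S ε ^ 2 := by
  have hXm : Measurable fun ω i => X i ω := measurable_pi_lambda _ hX
  have hmem : Q.map (fun ω i => X i ω) ∈ GAC n m S ε :=
    ⟨Ω, inferInstance, Q, inferInstance, X, Y, ⟨hXm.aemeasurable, rfl⟩, hY, hlaw, ae_of_all _ hXY⟩
  calc _ = risk (Q.map fun ω i => X i ω) est m ^ 2 := by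
        rw [risk_sq, lintegral_map (by fun_prop) hXm]
    _ ≤ _ := by
        gcongr
        exact le_iSup_of_le m (le_iSup₂_of_le _ hmem le_rfl)

/-- The sample `y(ω₁), …, y(ωₙ)` consists of i.i.d. Gaussian vectors, and `X` is a contaminated
version of it. -/
lemma lintegral_pi_le_maxRisk_sq {Ω : Type} [MeasurableSpace Ω] {Q : Measure Ω}
    [IsProbabilityMeasure Q] {m : EuclideanSpace ℝ (Fin p)} {y : Ω → EuclideanSpace ℝ (Fin p)}
    (hy : MeasurePreserving y Q (multivariateGaussian m S))
    {X : (Fin n → Ω) → Fin n → EuclideanSpace ℝ (Fin p)} (hX : Measurable X)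
    (hXy : ∀ ω, ({i | X ω i ≠ y (ω i)}.ncard : ℝ) ≤ ε * n) (hest : Measurable est) :
    ∫⁻ ω, ‖est (X ω) - m‖ₑ ^ 2 ∂Measure.pi (fun _ => Q) ≤ maxRisk est S ε ^ 2 := by
  have h1 : iIndepFun (fun (i : Fin n) (ω : Fin n → Ω) => y (ω i)) (Measure.pi fun _ => Q) :=
    iIndepFun_pi (X := fun _ => y) fun _ => hy.measurable.aemeasurable
  have h2 : ∀ i, HasLaw (fun ω : Fin n → Ω => y (ω i)) (multivariateGaussian m S)
      (Measure.pi fun _ => Q) := fun i =>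
    hy.hasLaw.comp (measurePreserving_eval (fun _ => Q) i).hasLaw
  exact lintegral_enorm_sq_le_maxRisk_sq (X := fun i ω => X ω i) hest
    (fun i => (measurable_pi_apply i).comp hX) h1 h2 hXy

end Risk

/-! ### The square root of the covariance matrix -/

section SqrtCovariance

open scoped ENNReal MatrixOrder

variable {p : ℕ} {S : Matrix (Fin p) (Fin p) ℝ}

/-- The operator `S^{1/2}` on Euclidean space, which maps a standard Gaussian vector to a vector
with law `N(0, S)`. -/
noncomputable def sqrtCLM (S : Matrix (Fin p) (Fin p) ℝ) :
    EuclideanSpace ℝ (Fin p) →L[ℝ] EuclideanSpace ℝ (Fin p) :=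
  Matrix.toEuclideanCLM (𝕜 := ℝ) (CFC.sqrt S)

lemma measurePreserving_add_sqrtCLM (m : EuclideanSpace ℝ (Fin p))
    (S : Matrix (Fin p) (Fin p) ℝ) :
    MeasurePreserving (fun x => m + sqrtCLM S x) (stdGaussian (EuclideanSpace ℝ (Fin p)))
      (multivariateGaussian m S) :=
  ⟨by fun_prop, rfl⟩

lemma norm_sqrtCLM_sq (hS : S.PosSemidef) : ‖sqrtCLM S‖ ^ 2 = opNorm S := by
  have h : IsSelfAdjoint (sqrtCLM S) := (CFC.sqrt_nonneg S).isSelfAdjoint.map _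
  have hmul : sqrtCLM S * sqrtCLM S = Matrix.toEuclideanCLM (𝕜 := ℝ) S := by
    rw [sqrtCLM, ← map_mul, CFC.sqrt_mul_sqrt_self S hS.nonneg]
  rw [opNorm, ← hmul, h.norm_mul_self]

lemma exists_norm_eq_one_opNorm_le (hS : S.PosSemidef) (h0 : 0 < opNorm S) :
    ∃ w : EuclideanSpace ℝ (Fin p), ‖w‖ = 1 ∧ opNorm S / 4 ≤ ‖sqrtCLM S w‖ ^ 2 := by
  have hsq := norm_sqrtCLM_sq hS
  have hpos : 0 < ‖sqrtCLM S‖₊ := by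
    rw [← hsq] at h0
    exact pow_pos_iff two_ne_zero |>.1 h0
  obtain ⟨w, hw, hlt⟩ :=
    (sqrtCLM S).exists_nnnorm_eq_one_lt_apply_of_lt_opNNNorm (NNReal.half_lt_self hpos.ne')
  have hlt' : ‖sqrtCLM S‖ / 2 < ‖sqrtCLM S w‖ := by exact_mod_cast hlt
  refine ⟨w, by simpa using congrArg NNReal.toReal hw, ?_⟩
  rw [← hsq]
  nlinarith [norm_nonneg (sqrtCLM S)]

lemma lintegral_enorm_sq_gaussianReal (v : NNReal) :
    ∫⁻ x, ‖x‖ₑ ^ 2 ∂gaussianReal 0 v = v := by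
  have h := ofReal_variance (X := fun x : ℝ => x) (μ := gaussianReal 0 v)
    (IsGaussian.memLp_two_id)
  rw [variance_fun_id_gaussianReal, ENNReal.ofReal_coe_nnreal, evariance] at h
  simpa using h.symm

lemma lintegral_enorm_sqrtCLM_sq (hS : S.PosSemidef) :
    ∫⁻ x, ‖sqrtCLM S x‖ₑ ^ 2 ∂stdGaussian (EuclideanSpace ℝ (Fin p)) =
      ENNReal.ofReal S.trace := by
  have hnorm : ∀ y : EuclideanSpace ℝ (Fin p), ‖y‖ₑ ^ 2 = ∑ i, ‖y i‖ₑ ^ 2 := fun y => by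
    simp only [← ofReal_norm, ← ENNReal.ofReal_pow (norm_nonneg _)]
    rw [EuclideanSpace.norm_sq_eq, ENNReal.ofReal_sum_of_nonneg fun _ _ => by positivity]
  have h := (measurePreserving_add_sqrtCLM 0 S).lintegral_comp (f := fun y => ‖y‖ₑ ^ 2)
    (by fun_prop)
  simp only [zero_add] at h
  rw [h]
  simp_rw [hnorm]
  rw [lintegral_finsetSum _ fun i _ => by fun_prop, Matrix.trace,
    ENNReal.ofReal_sum_of_nonneg (f := S.diag) fun i _ => hS.diag_nonneg]
  refine Finset.sum_congr rfl fun i _ => ?_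
  have hi := (measurePreserving_eval_multivariateGaussian (μ := 0) hS (i := i)).lintegral_comp
    (f := fun y => ‖y‖ₑ ^ 2) (by fun_prop)
  rw [hi, PiLp.zero_apply, lintegral_enorm_sq_gaussianReal]
  rfl

end SqrtCovariance

/-! ### The sampling error -/

section SamplingError

open scoped ENNReal

variable {n p : ℕ} {S : Matrix (Fin p) (Fin p) ℝ} {ε : ℝ}
  {est : (Fin n → EuclideanSpace ℝ (Fin p)) → EuclideanSpace ℝ (Fin p)}

/-- The Bayes risk for the prior `N(0, S / n)` on the mean: if `x₀, …, xₙ` are i.i.d. standard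
Gaussian, the mean is `S^{1/2} x₀ / √n` and the noise is `S^{1/2} xᵢ`. A reflection of the index
space fixes all observations, preserves the law and moves the mean. -/
lemma ofReal_trace_div_le_maxRisk_sq (hn : 0 < n) (hS : S.PosSemidef) (hε : 0 ≤ ε)
    (hest : Measurable est) :
    ENNReal.ofReal (S.trace / (2 * n)) ≤ maxRisk est S ε ^ 2 := by
  let E := EuclideanSpace ℝ (Fin p)
  let γ : Measure E := stdGaussian E
  have hn' : (0 : ℝ) < n := by exact_mod_cast hn
  set a : ℝ := (√2)⁻¹
  set b : ℝ := (√n)⁻¹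
  have ha : a ^ 2 = 1 / 2 := by simp [a]
  have hb : b ^ 2 = 1 / n := by simp [b]
  -- The reflection must fix `xᵢ + x₀ / √n`, which forces `uᵢ = -u₀ / √n`.
  let u : Fin (n + 1) → ℝ := Fin.cons a fun _ => -(a * b)
  have hu : ∑ i, u i ^ 2 = 1 := by
    simp only [u, Fin.sum_univ_succ, Fin.cons_zero, Fin.cons_succ, neg_sq, mul_pow, ha, hb]
    simp
    field_simp
    norm_num
  let W : (Fin (n + 1) → E) → E := fun x => ∑ j, u j • x j
  let T : (Fin (n + 1) → E) → (Fin (n + 1) → E) := fun x i => x i - (2 * u i) • W x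
  have hT : MeasurePreserving T (Measure.pi fun _ => γ) (Measure.pi fun _ => γ) :=
    measurePreserving_reflection_stdGaussian hu
  let mean : E → E := fun y => b • sqrtCLM S y
  let obs : (Fin (n + 1) → E) → Fin n → E := fun x i => mean (x 0) + sqrtCLM S (x i.succ)
  have hobs : ∀ x, obs (T x) = obs x := fun x => by
    ext1 i
    simp only [obs, mean, T, u, Fin.cons_zero, Fin.cons_succ, map_sub, map_smul]
    module
  have hmean : ∀ x, mean (x 0) - mean (T x 0) = (2 * a * b) • sqrtCLM S (W x) := fun x => by
    simp only [mean, T, u, Fin.cons_zero, map_sub, map_smul]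
    module
  let err : (Fin (n + 1) → E) → ℝ≥0∞ := fun x => ‖est (obs x) - mean (x 0)‖ₑ ^ 2
  have herr : Measurable err := by fun_prop
  have hbayes : ∫⁻ x, err x ∂(Measure.pi fun _ => γ) ≤ maxRisk est S ε ^ 2 := by
    have h := (measurePreserving_piFinSuccAbove (fun _ : Fin (n + 1) => γ) 0).lintegral_comp
      (f := fun q => ‖est (fun i => mean q.1 + sqrtCLM S (q.2 i)) - mean q.1‖ₑ ^ 2)
      (by fun_prop)
    calc ∫⁻ x, err x ∂(Measure.pi fun _ => γ) = _ := h
      _ = _ := lintegral_prod _ (Measurable.aemeasurable (by fun_prop))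
      _ ≤ ∫⁻ _, maxRisk est S ε ^ 2 ∂γ :=
          lintegral_mono fun y =>
            lintegral_pi_le_maxRisk_sq (X := fun x i => mean y + sqrtCLM S (x i))
              (measurePreserving_add_sqrtCLM (mean y) S) (by fun_prop)
              (fun x => by simpa using mul_nonneg hε hn'.le) hest
      _ = _ := by simp
  have hmove : ∫⁻ x, ‖mean (x 0) - mean (T x 0)‖ₑ ^ 2 ∂(Measure.pi fun _ => γ) =
      ENNReal.ofReal (4 * (S.trace / (2 * n))) := by
    have h := (measurePreserving_sum_smul_stdGaussian (V := E) hu).lintegral_comp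
      (f := fun y => ‖sqrtCLM S y‖ₑ ^ 2) (by fun_prop)
    simp_rw [hmean, enorm_smul, mul_pow]
    rw [lintegral_const_mul _ (by fun_prop), h, lintegral_enorm_sqrtCLM_sq hS,
      ← ofReal_norm, ← ENNReal.ofReal_pow (norm_nonneg _),
      ← ENNReal.ofReal_mul (by positivity), Real.norm_eq_abs, sq_abs, mul_pow, mul_pow, ha, hb]
    congr 1
    field_simp
    ring
  have hle : 4 * ENNReal.ofReal (S.trace / (2 * n)) ≤ 4 * maxRisk est S ε ^ 2 := by
    rw [← ENNReal.ofReal_ofNat 4, ← ENNReal.ofReal_mul (by norm_num), ← hmove]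
    calc _ ≤ ∫⁻ x, 2 * (err x + err (T x)) ∂(Measure.pi fun _ => γ) := by
          refine lintegral_mono fun x => (enorm_sub_sq_le _ _ (est (obs x))).trans_eq ?_
          simp only [err, hobs]
      _ = 2 * (∫⁻ x, err x ∂(Measure.pi fun _ => γ) + ∫⁻ x, err x ∂(Measure.pi fun _ => γ)) := by
          rw [lintegral_const_mul _ (by fun_prop), lintegral_add_left herr,
            hT.lintegral_comp herr]
      _ ≤ 2 * (maxRisk est S ε ^ 2 + maxRisk est S ε ^ 2) := by gcongr
      _ = _ := by
          rw [ENNReal.ofReal_ofNat]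
          ring
  exact (ENNReal.mul_le_mul_iff_right (by norm_num) (by norm_num)).1 hle

end SamplingError

/-! ### The error due to contamination -/

section Contamination

open scoped ENNReal

lemma natCast_ncard_eq_sum_indicator {Ω : Type*} {n : ℕ} (B : Set Ω) (ω : Fin n → Ω) :
    (({i | ω i ∈ B}.ncard : ℕ) : ℝ≥0∞) = ∑ i, B.indicator 1 (ω i) := by
  classical
  simp [Set.ncard_eq_toFinset_card', Set.indicator_apply, Finset.sum_boole]

/-- Markov's inequality for the number of points of an i.i.d. sample that fall in `B`. -/
lemma one_le_measure_add_half {Ω : Type*} [MeasurableSpace Ω] {Q : Measure Ω}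
    [IsProbabilityMeasure Q] {B : Set Ω} (hB : MeasurableSet B) {n : ℕ} (hn : 0 < n) {ε : ℝ}
    (hε : 0 < ε) (hQB : Q B ≤ ENNReal.ofReal (ε / 2)) :
    1 ≤ Measure.pi (fun _ : Fin n => Q)
      {ω | ∑ i, B.indicator 1 (ω i) ≤ ENNReal.ofReal (ε * n)} + 1 / 2 := by
  have hn' : (0 : ℝ) < n := by exact_mod_cast hn
  set P := Measure.pi (fun _ : Fin n => Q)
  let N : (Fin n → Ω) → ℝ≥0∞ := fun ω => ∑ i, B.indicator 1 (ω i)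
  have hind : Measurable (B.indicator (1 : Ω → ℝ≥0∞)) := measurable_one.indicator hB
  have hN : Measurable N := by fun_prop
  have hG : MeasurableSet {ω | N ω ≤ ENNReal.ofReal (ε * n)} := measurableSet_le hN measurable_const
  have hint : ∫⁻ ω, N ω ∂P ≤ ENNReal.ofReal (ε * n) * (1 / 2) := by
    calc ∫⁻ ω, N ω ∂P = ∑ _i : Fin n, Q B := by
          rw [lintegral_finsetSum _ fun i _ => by fun_prop]
          refine Finset.sum_congr rfl fun i _ => ?_
          rw [(measurePreserving_eval (fun _ : Fin n => Q) i).lintegral_comp hind,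
            lintegral_indicator_one hB]
      _ ≤ ∑ _i : Fin n, ENNReal.ofReal (ε / 2) := Finset.sum_le_sum fun _ _ => hQB
      _ = ENNReal.ofReal (ε * n) * (1 / 2) := by
          rw [Finset.sum_const, Finset.card_univ, Fintype.card_fin, nsmul_eq_mul,
            ← ENNReal.ofReal_natCast, ← ENNReal.ofReal_mul (by positivity),
            show (1 / 2 : ℝ≥0∞) = ENNReal.ofReal (1 / 2) by
              rw [ENNReal.ofReal_div_of_pos (by norm_num)]; simp,
            ← ENNReal.ofReal_mul (by positivity)]
          congr 1
          ring
  have hbad : P {ω | N ω ≤ ENNReal.ofReal (ε * n)}ᶜ ≤ 1 / 2 := by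
    have hpos : ENNReal.ofReal (ε * n) ≠ 0 := by
      simpa using by positivity
    refine (ENNReal.mul_le_mul_iff_right hpos ENNReal.ofReal_ne_top).1 (le_trans ?_ hint)
    refine le_trans ?_ (mul_meas_ge_le_lintegral hN (ENNReal.ofReal (ε * n)))
    gcongr
    intro ω hω
    have : ¬ N ω ≤ ENNReal.ofReal (ε * n) := hω
    exact (not_le.1 this).le
  calc (1 : ℝ≥0∞) =
      P {ω | N ω ≤ ENNReal.ofReal (ε * n)} + P {ω | N ω ≤ ENNReal.ofReal (ε * n)}ᶜ := by
        rw [measure_add_measure_compl hG, measure_univ]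
    _ ≤ _ := by gcongr

variable {n p : ℕ} {S : Matrix (Fin p) (Fin p) ℝ} {ε : ℝ}
  {est : (Fin n → EuclideanSpace ℝ (Fin p)) → EuclideanSpace ℝ (Fin p)}

/-- Two-point lower bound: if `N(m, S)` and `N(m', S)` have a coupling whose coordinates agree
outside an event of probability `ε / 2`, then with probability at least `1 / 2` the adversary can
turn a sample from the former law into a sample from the latter. -/
lemma ofReal_norm_sub_sq_le_maxRisk_sq {Ω : Type} [MeasurableSpace Ω] {Q : Measure Ω}
    [IsProbabilityMeasure Q] {m m' : EuclideanSpace ℝ (Fin p)}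
    {y y' : Ω → EuclideanSpace ℝ (Fin p)}
    (hy : MeasurePreserving y Q (multivariateGaussian m S))
    (hy' : MeasurePreserving y' Q (multivariateGaussian m' S))
    {B : Set Ω} (hB : MeasurableSet B) (hyB : ∀ ω ∉ B, y' ω = y ω)
    (hn : 0 < n) (hε : 0 < ε) (hQB : Q B ≤ ENNReal.ofReal (ε / 2)) (hest : Measurable est) :
    ENNReal.ofReal (‖m - m'‖ ^ 2 / 8) ≤ maxRisk est S ε ^ 2 := by
  classical
  set P := Measure.pi (fun _ : Fin n => Q)
  set G : Set (Fin n → Ω) := {ω | ∑ i, B.indicator 1 (ω i) ≤ ENNReal.ofReal (ε * n)} with hGdef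
  have hPG : 1 ≤ P G + 1 / 2 := one_le_measure_add_half hB hn hε hQB
  have hind : Measurable (B.indicator (1 : Ω → ℝ≥0∞)) := measurable_one.indicator hB
  have hG : MeasurableSet G := measurableSet_le (by fun_prop) measurable_const
  have hym := hy.measurable
  have hym' := hy'.measurable
  have hεn : 0 ≤ ε * n := by positivity
  -- The adversary replaces the sample `y` by `y'` whenever the budget allows it.
  let X : (Fin n → Ω) → Fin n → EuclideanSpace ℝ (Fin p) :=
    G.piecewise (fun ω i => y' (ω i)) (fun ω i => y (ω i))
  have hX : Measurable X := Measurable.piecewise hG (by fun_prop) (by fun_prop)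
  have hcount : ∀ ω, ({i | X ω i ≠ y (ω i)}.ncard : ℝ) ≤ ε * n := fun ω => by
    by_cases hω : ω ∈ G
    · have hsub : {i | X ω i ≠ y (ω i)} ⊆ {i | ω i ∈ B} := fun i hi => by
        by_contra hiB
        exact hi (by simp only [X, Set.piecewise_eq_of_mem _ _ _ hω]; exact hyB _ hiB)
      have hle : (({i | ω i ∈ B}.ncard : ℕ) : ℝ) ≤ ε * n := by
        rw [hGdef, Set.mem_ofPred_eq, ← natCast_ncard_eq_sum_indicator,
          ← ENNReal.ofReal_natCast] at hω
        exact (ENNReal.ofReal_le_ofReal_iff hεn).1 hω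
      exact le_trans (by exact_mod_cast Set.ncard_le_ncard hsub) hle
    · have : {i | X ω i ≠ y (ω i)} = ∅ := by
        ext i
        simp [X, Set.piecewise_eq_of_notMem _ _ _ hω]
      simpa [this] using hεn
  have h1 : ∫⁻ ω in G, ‖est (fun i => y' (ω i)) - m‖ₑ ^ 2 ∂P ≤ maxRisk est S ε ^ 2 := by
    calc _ = ∫⁻ ω in G, ‖est (X ω) - m‖ₑ ^ 2 ∂P := by
          refine setLIntegral_congr_fun hG fun ω hω => ?_
          simp only [X, Set.piecewise_eq_of_mem _ _ _ hω]
      _ ≤ ∫⁻ ω, ‖est (X ω) - m‖ₑ ^ 2 ∂P := setLIntegral_le_lintegral _ _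
      _ ≤ _ := lintegral_pi_le_maxRisk_sq hy hX hcount hest
  have h2 : ∫⁻ ω in G, ‖est (fun i => y' (ω i)) - m'‖ₑ ^ 2 ∂P ≤ maxRisk est S ε ^ 2 :=
    (setLIntegral_le_lintegral _ _).trans <|
      lintegral_pi_le_maxRisk_sq (X := fun ω i => y' (ω i)) hy' (by fun_prop)
        (fun ω => by simpa using hεn) hest
  have h3 : ‖m - m'‖ₑ ^ 2 * P G ≤ 4 * maxRisk est S ε ^ 2 := by
    calc _ = ∫⁻ _ in G, ‖m - m'‖ₑ ^ 2 ∂P := (setLIntegral_const _ _).symm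
      _ ≤ ∫⁻ ω in G, 2 * (‖est (fun i => y' (ω i)) - m‖ₑ ^ 2 +
            ‖est (fun i => y' (ω i)) - m'‖ₑ ^ 2) ∂P :=
          lintegral_mono fun ω => enorm_sub_sq_le _ _ _
      _ ≤ 2 * (maxRisk est S ε ^ 2 + maxRisk est S ε ^ 2) := by
          rw [lintegral_const_mul _ (by fun_prop), lintegral_add_left (by fun_prop)]
          gcongr
      _ = _ := by ring
  have h4 : (1 / 2 : ℝ≥0∞) ≤ P G := by
    rw [← tsub_le_iff_right] at hPG
    simpa using hPG
  refine (ENNReal.mul_le_mul_iff_right (a := 4) (by norm_num) (by norm_num)).1 ?_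
  calc 4 * ENNReal.ofReal (‖m - m'‖ ^ 2 / 8) = ‖m - m'‖ₑ ^ 2 * (1 / 2) := by
        rw [← ofReal_norm, ← ENNReal.ofReal_pow (norm_nonneg _),
          show (1 / 2 : ℝ≥0∞) = ENNReal.ofReal (1 / 2) by
            rw [ENNReal.ofReal_div_of_pos (by norm_num)]; simp,
          ← ENNReal.ofReal_ofNat 4, ← ENNReal.ofReal_mul (by norm_num),
          ← ENNReal.ofReal_mul (by positivity)]
        congr 1
        ring
    _ ≤ ‖m - m'‖ₑ ^ 2 * P G := by gcongr
    _ ≤ _ := h3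

open scoped RealInnerProductSpace in
/-- The two means are `0` and `ε S^{1/2} w`, where the unit vector `w` nearly maximizes
`‖S^{1/2} w‖`. -/
lemma ofReal_opNorm_le_maxRisk_sq (hn : 0 < n) (hS : S.PosSemidef) (hε : 0 < ε)
    (h0 : 0 < opNorm S) (hest : Measurable est) :
    ENNReal.ofReal (ε ^ 2 * opNorm S / 32) ≤ maxRisk est S ε ^ 2 := by
  obtain ⟨w, hw, hSw⟩ := exists_norm_eq_one_opNorm_le hS h0
  obtain ⟨ρ, _, hfst, hsnd, hne⟩ := exists_coupling_gaussianReal hε.le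
  let E := EuclideanSpace ℝ (Fin p)
  let Q : Measure (E × (ℝ × ℝ)) := (stdGaussian E).prod ρ
  let f : E × ℝ → E := fun q => q.1 - ⟪q.1, w⟫ • w + q.2 • w
  have hf : MeasurePreserving f ((stdGaussian E).prod (gaussianReal 0 1)) (stdGaussian E) :=
    measurePreserving_replace_coord hw
  have hfst' : MeasurePreserving Prod.fst ρ (gaussianReal 0 1) := ⟨measurable_fst, hfst⟩
  have hsnd' : MeasurePreserving (fun s : ℝ × ℝ => s.2 - ε) ρ (gaussianReal 0 1) := by
    refine ⟨by fun_prop, ?_⟩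
    have : (fun s : ℝ × ℝ => s.2 - ε) = (· - ε) ∘ Prod.snd := rfl
    rw [this, ← Measure.map_map (by fun_prop) measurable_snd, hsnd, gaussianReal_map_sub_const,
      sub_self]
  let y : E × (ℝ × ℝ) → E := fun q => 0 + sqrtCLM S (f (q.1, q.2.1))
  let y' : E × (ℝ × ℝ) → E := fun q => ε • sqrtCLM S w + sqrtCLM S (f (q.1, q.2.2 - ε))
  have hy : MeasurePreserving y Q (multivariateGaussian 0 S) :=
    (measurePreserving_add_sqrtCLM 0 S).comp (hf.comp ((MeasurePreserving.id _).prod hfst'))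
  have hy' : MeasurePreserving y' Q (multivariateGaussian (ε • sqrtCLM S w) S) :=
    (measurePreserving_add_sqrtCLM _ S).comp (hf.comp ((MeasurePreserving.id _).prod hsnd'))
  have hdiag : MeasurableSet {s : ℝ × ℝ | s.1 ≠ s.2} := measurableSet_diagonal.compl
  have hQB : Q (Prod.snd ⁻¹' {s : ℝ × ℝ | s.1 ≠ s.2}) ≤ ENNReal.ofReal (ε / 2) := by
    rw [(measurePreserving_snd (μ := stdGaussian E) (ν := ρ)).measure_preimage
      hdiag.nullMeasurableSet]
    exact hne
  refine le_trans (ENNReal.ofReal_le_ofReal ?_) (ofReal_norm_sub_sq_le_maxRisk_sq hy hy'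
    (measurable_snd hdiag) (fun q hq => ?_) hn hε hQB hest)
  · rw [zero_sub, norm_neg, norm_smul, mul_pow, Real.norm_eq_abs, sq_abs]
    nlinarith [sq_nonneg ε]
  · have hq' : q.2.1 = q.2.2 := by simpa using hq
    simp only [y, y', f, hq', map_add, map_smul, map_sub]
    module

end Contamination

end RobustMean

theorem mainTheorem9 :
    ∃ c : ℝ, 0 < c ∧ ∃ c' : ℝ, 0 < c' ∧
      ∀ (n p : ℕ) (S : Matrix (Fin p) (Fin p) ℝ) (ε : ℝ),
        c' < (n : ℝ) → S.PosSemidef → 0 < ε → ε < 1 / 2 →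
        ENNReal.ofReal
            (c * Real.sqrt (RobustMean.opNorm S) *
              (Real.sqrt (RobustMean.effRank S / (n : ℝ)) + ε)) ≤
          ⨅ (est : (Fin n → EuclideanSpace ℝ (Fin p)) → EuclideanSpace ℝ (Fin p))
            (_ : Measurable est), RobustMean.maxRisk est S ε := by
  -- With `R` the maximal risk, the two terms of the bound are at most `2 R` and `6 R`, and
  -- `(2 + 6) / 12 ≤ 1`.
  refine ⟨1 / 12, by norm_num, 1, one_pos, fun n p S ε hn hS hε _ => ?_⟩
  refine le_iInf₂ fun est hest => ?_
  have hn0 : 0 < n := by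
    have : (0 : ℝ) < n := by linarith
    exact_mod_cast this
  have hop : 0 ≤ RobustMean.opNorm S := norm_nonneg _
  rcases hop.eq_or_lt with h0 | h0
  -- For `S = 0` the effective rank is `0 / 0 = 0`, but the factor `√(opNorm S)` vanishes anyway.
  · simp [← h0]
  rcases eq_or_ne (RobustMean.maxRisk est S ε) ⊤ with htop | htop
  · simp [htop]
  have h1 := RobustMean.ofReal_trace_div_le_maxRisk_sq hn0 hS hε.le hest
  have h2 := RobustMean.ofReal_opNorm_le_maxRisk_sq hn0 hS hε h0 hest
  lift RobustMean.maxRisk est S ε to NNReal using htop with R hR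
  have hsq : ((R : ENNReal)) ^ 2 = ENNReal.ofReal ((R : ℝ) ^ 2) := by
    rw [ENNReal.ofReal_pow R.coe_nonneg, ENNReal.ofReal_coe_nnreal]
  rw [hsq, ENNReal.ofReal_le_ofReal_iff (by positivity)] at h1 h2
  rw [← ENNReal.ofReal_coe_nnreal]
  apply ENNReal.ofReal_le_ofReal
  have htr : √(RobustMean.opNorm S) * √(RobustMean.effRank S / n) ≤ 2 * R := by
    rw [← Real.sqrt_mul hop, RobustMean.effRank]
    refine Real.sqrt_le_iff.2 ⟨by positivity, ?_⟩
    have : RobustMean.opNorm S * (S.trace / RobustMean.opNorm S / n) =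
        2 * (S.trace / (2 * n)) := by
      field_simp
    rw [this]
    nlinarith [sq_nonneg (R : ℝ)]
  have hcont : √(RobustMean.opNorm S) * ε ≤ 6 * R := by
    refine abs_le_of_sq_le_sq' ?_ (by positivity) |>.2
    rw [mul_pow, Real.sq_sqrt hop]
    nlinarith [sq_nonneg (R : ℝ)]
  nlinarith [R.coe_nonneg]
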